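/- All rings are commutative with identity and need not be Noetherian; all modules are unital. Let $R$ be a ring, $M$ an $R$-module and $\mathbf x=x_1,\dots,x_\ell$ a finite sequence in $R$. The sequence $\mathbf x$ is $M$-regular if $x_i$ is a non-zero-divisor on $M/(x_1,\dots,x_{i-1})M$ for $i=1,\dots,\ell$ and $\mathbf xM\neq M$. For $m\ge n$ let $\varphi^m_n\colon \mathbb K_\bullet(\mathbf x^m,M)\to\mathbb K_\bullet(\mathbf x^n,M)$ be the tensor product over $j$ of the chain maps of Koszul complexes $\mathbb K_\bullet(x_j^m)\to\mathbb K_\bullet(x_j^n)$ that are multiplication by $x_j^{m-n}$ in degree $1$ and the identity in degree $0$. The sequence $\mathbf x$ is $M$-weakly proregular if for each $n$ there is $m\ge n$ such that $\varphi^m_n$ induces the zero map $H_i(\mathbf x^m,M)\to H_i(\mathbf x^n,M)$ on Koszul homology for all $i\ge1$. It is a parameter sequence on $M$ if it is $M$-weakly proregular, $\mathbf xM\ne M$, and $H^{\ell}_{\mathbf x}(M)_{\mathfrak p}\neq0$ for every prime $\mathfrak p\in\operatorname{Supp}_R(M/\mathbf xM)$, where $H^i_{\mathbf x}(M)$ is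 the $i$-th cohomology of the Čech complex of $M$ with respect to $\mathbf x$. It is a strong parameter sequence on $M$ if $x_1,\dots,x_i$ is a parameter sequence on $M$ for $i=1,\dots,\ell$. By convention the empty sequence is a (strong) parameter sequence and a regular sequence on every module. The module $M$ is Cohen–Macaulay if every strong parameter sequence on $M$ is an $M$-regular sequence; a ring is Cohen–Macaulay if it is so as a module over itself. **Proposition.** Let $R$ and $S$ be commutative rings, $J$ an ideal of $S$ and $f\colon R\to S$ a ring homomorphism. Regard $J$ as an $R$-module through $f$, and let $R\bowtie^fJ=\{(r,f(r)+j): r\in R,\ j\in J\}\subseteq R\times S$ be the amalgamation of $R$ with $S$ along $J$ with respect to $f$. Assume that $J$ is flat over $R$ and that the ring $R\bowtie^fJ$ is Cohen–Macaulay. Then $R$ is Cohen–Macaulay. If, moreover, every strong parameter sequence (of elements of $R$) on $J$ is a strong parameter sequence on $R$, then $J$ is a Cohen–Macaulay $R$-module. -/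

import Mathlib

namespace NonNoethCM

universe u v

section Koszul

variable {R : Type u} [CommRing R] {ℓ : ℕ} (x : Fin ℓ → R) (M : Type v) [AddCommGroup M] [Module R M]

/-- The sign `(-1) ^ #{k ∈ s | k < j}` attached to an index `j` and a set of indices `s`. -/
def sgn (R : Type u) [CommRing R] {ℓ : ℕ} (s : Finset (Fin ℓ)) (j : Fin ℓ) : R := (-1) ^ (s.filter (· < j)).card

/-- The differential of the (total) Koszul complex `K(x₁, M) ⊗ ⋯ ⊗ K(x_ℓ, M)`.
The module `⨁ᵢ Kᵢ(x, M)` is the module of all families `z` of elements of `M` indexed by the subsets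
`s` of `{1, …, ℓ}` (`z s` is the coefficient of the basis element `e_s`). -/
def koszulD : (Finset (Fin ℓ) → M) →ₗ[R] (Finset (Fin ℓ) → M) where
  toFun z s := ∑ j ∈ sᶜ, sgn R s j • x j • z (insert j s)
  map_add' z w := by
    funext s
    simp [smul_add, Finset.sum_add_distrib]
  map_smul' r z := by
    funext s
    simp only [Pi.smul_apply, RingHom.id_apply, Finset.smul_sum]
    refine Finset.sum_congr rfl fun j _ => ?_
    rw [smul_comm (x j) r, smul_comm (sgn R s j) r]

/-- `Kᵢ(x, M)`: the families supported on the subsets with exactly `i` elements. -/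
def koszulChains (_x : Fin ℓ → R) (i : ℕ) : Submodule R (Finset (Fin ℓ) → M) where
  carrier := {z | ∀ s, s.card ≠ i → z s = 0}
  add_mem' {z w} hz hw s hs := by simp [hz s hs, hw s hs]
  zero_mem' s _ := rfl
  smul_mem' r z hz s hs := by simp [hz s hs]

/-- The `i`-cycles of the Koszul complex. -/
def koszulCycles (i : ℕ) : Submodule R (Finset (Fin ℓ) → M) :=
  koszulChains M x i ⊓ LinearMap.ker (koszulD x M)

/-- The `i`-boundaries of the Koszul complex. -/
def koszulBoundaries (i : ℕ) : Submodule R (Finset (Fin ℓ) → M) :=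
  (koszulChains M x (i + 1)).map (koszulD x M)

theorem sgn_insert (s : Finset (Fin ℓ)) {j k : Fin ℓ} (hj : j ∉ s) :
    sgn R (insert j s) k = if j < k then - sgn R s k else sgn R s k := by
  unfold sgn
  rw [Finset.filter_insert]
  split_ifs with h
  · rw [Finset.card_insert_of_notMem (by simp [hj]), pow_succ, mul_neg_one]
  · rfl

theorem sgn_swap (s : Finset (Fin ℓ)) {j k : Fin ℓ} (hj : j ∉ s) (hk : k ∉ s) (hjk : j ≠ k) :
    sgn R s j * sgn R (insert j s) k + sgn R s k * sgn R (insert k s) j = 0 := by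
  rw [sgn_insert s hj, sgn_insert s hk]
  rcases lt_or_gt_of_ne hjk with h | h
  · rw [if_pos h, if_neg h.not_gt]
    ring
  · rw [if_neg h.not_gt, if_pos h]
    ring

/-- The Koszul differential squares to zero. -/
theorem koszulD_koszulD (z : Finset (Fin ℓ) → M) : koszulD x M (koszulD x M z) = 0 := by
  funext s
  simp only [koszulD, LinearMap.coe_mk, AddHom.coe_mk, Finset.smul_sum, Pi.zero_apply]
  rw [Finset.sum_sigma']
  refine Finset.sum_involution (fun a _ => ⟨a.2, a.1⟩) ?_ ?_ ?_ ?_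
  · rintro ⟨j, k⟩ h
    simp only [Finset.mem_sigma, Finset.mem_compl, Finset.mem_insert, not_or] at h
    dsimp only
    rw [Finset.insert_comm j k s]
    simp only [smul_smul, ← add_smul]
    have hs := sgn_swap (R := R) s h.1 h.2.2 (Ne.symm h.2.1)
    convert zero_smul R (z (insert k (insert j s))) using 2
    linear_combination (x j * x k) * hs
  · rintro ⟨j, k⟩ h _ he
    simp only [Finset.mem_sigma, Finset.mem_compl, Finset.mem_insert, not_or] at h
    simp only [Sigma.mk.injEq, heq_eq_eq] at he
    exact h.2.1 he.1
  · rintro ⟨j, k⟩ h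
    simp only [Finset.mem_sigma, Finset.mem_compl, Finset.mem_insert, not_or] at h ⊢
    exact ⟨h.2.2, Ne.symm h.2.1, h.1⟩
  · rintro ⟨j, k⟩ _
    rfl

theorem koszulBoundaries_le_cycles (i : ℕ) : koszulBoundaries x M i ≤ koszulCycles x M i := by
  rintro _ ⟨w, hw, rfl⟩
  refine ⟨fun s hs => ?_, koszulD_koszulD x M w⟩
  simp only [koszulD, LinearMap.coe_mk, AddHom.coe_mk]
  refine Finset.sum_eq_zero fun j hj => ?_
  rw [hw (insert j s) (by rw [Finset.card_insert_of_notMem (by simpa using hj)]; omega)]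
  simp

/-- The Koszul homology `Hᵢ(x, M)`. -/
abbrev KoszulHomology (i : ℕ) : Type v :=
  koszulCycles x M i ⧸ (koszulBoundaries x M i).submoduleOf (koszulCycles x M i)

/-- The map `φ = φ(x₁, M) ⊗ ⋯ ⊗ φ(x_ℓ, M)` from the Koszul complex of `x₁ᵐ, …, x_ℓᵐ` to that of
`x₁ⁿ, …, x_ℓⁿ`, for `n ≤ m`: on the coefficient of `e_s` it is multiplication by
`∏ j ∈ s, x_j ^ (m - n)`. -/
def koszulPhi (n m : ℕ) : (Finset (Fin ℓ) → M) →ₗ[R] (Finset (Fin ℓ) → M) where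
  toFun z s := (∏ j ∈ s, x j ^ (m - n)) • z s
  map_add' z w := by
    funext s
    simp
  map_smul' r z := by
    funext s
    simp only [Pi.smul_apply, RingHom.id_apply]
    rw [smul_comm]

theorem koszulPhi_comm {n m : ℕ} (h : n ≤ m) (z : Finset (Fin ℓ) → M) :
    koszulD (x ^ n) M (koszulPhi x M n m z) = koszulPhi x M n m (koszulD (x ^ m) M z) := by
  funext s
  simp only [koszulD, koszulPhi, LinearMap.coe_mk, AddHom.coe_mk, Finset.smul_sum, Pi.pow_apply]
  refine Finset.sum_congr rfl fun j hj => ?_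
  rw [Finset.prod_insert (by simpa using hj)]
  simp only [smul_smul]
  congr 1
  rw [← Nat.add_sub_cancel' h, pow_add, Nat.add_sub_cancel_left]
  ring

theorem koszulPhi_mem_cycles {n m : ℕ} (h : n ≤ m) (i : ℕ) (z : Finset (Fin ℓ) → M)
    (hz : z ∈ koszulCycles (x ^ m) M i) : koszulPhi x M n m z ∈ koszulCycles (x ^ n) M i := by
  refine ⟨fun s hs => ?_, ?_⟩
  · have := hz.1 s hs
    simp [koszulPhi, this]
  · have h2 : koszulD (x ^ m) M z = 0 := hz.2
    change koszulD (x ^ n) M (koszulPhi x M n m z) = 0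
    rw [koszulPhi_comm x M h, h2, map_zero]

theorem koszulPhi_mem_boundaries {n m : ℕ} (h : n ≤ m) (i : ℕ) (z : Finset (Fin ℓ) → M)
    (hz : z ∈ koszulBoundaries (x ^ m) M i) :
    koszulPhi x M n m z ∈ koszulBoundaries (x ^ n) M i := by
  obtain ⟨w, hw, rfl⟩ := hz
  refine ⟨koszulPhi x M n m w, fun s hs => ?_, koszulPhi_comm x M h w⟩
  have := hw s hs
  simp [koszulPhi, this]

/-- The map `Hᵢ(xᵐ, M) → Hᵢ(xⁿ, M)` induced by `φ`, for `n ≤ m`. -/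
def koszulHomologyMap {n m : ℕ} (h : n ≤ m) (i : ℕ) :
    KoszulHomology (x ^ m) M i →ₗ[R] KoszulHomology (x ^ n) M i :=
  Submodule.mapQ _ _ ((koszulPhi x M n m).restrict (koszulPhi_mem_cycles x M h i))
    fun z hz => koszulPhi_mem_boundaries x M h i z hz

/-- `x` is an `M`-weakly proregular sequence. -/
def IsWeaklyProregular : Prop :=
  ∀ n : ℕ, ∃ m : ℕ, ∃ h : n ≤ m, ∀ i : ℕ, 1 ≤ i → koszulHomologyMap x M h i = 0

end Koszul

section Cech

variable {R : Type u} [CommRing R] {ℓ : ℕ} (x : Fin ℓ → R) (M : Type v) [AddCommGroup M] [Module R M]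

/-- The localization of `M` at the powers of `∏ j ∈ s, x j`. -/
abbrev CechPiece (s : Finset (Fin ℓ)) : Type (max u v) :=
  LocalizedModule (Submonoid.powers (∏ j ∈ s, x j)) M

theorem isUnit_of_mem_powers {s t : Finset (Fin ℓ)} (h : s ⊆ t)
    (a : Submonoid.powers (∏ j ∈ s, x j)) :
    IsUnit (algebraMap R (Module.End R (CechPiece x M t)) a) := by
  obtain ⟨_, k, rfl⟩ := a
  have hu : IsUnit (algebraMap R (Module.End R (CechPiece x M t)) (∏ j ∈ t, x j)) :=
    IsLocalizedModule.map_units (LocalizedModule.mkLinearMap _ M)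
      (⟨_, Submonoid.mem_powers _⟩ : Submonoid.powers (∏ j ∈ t, x j))
  have he : ∏ j ∈ t, x j = (∏ j ∈ s, x j) * ∏ j ∈ t \ s, x j := by
    rw [← Finset.prod_sdiff h, mul_comm]
  have hu : IsUnit (algebraMap R (Module.End R (CechPiece x M t)) (∏ j ∈ s, x j) *
      algebraMap R (Module.End R (CechPiece x M t)) (∏ j ∈ t \ s, x j)) := by
    rw [← map_mul, ← he]
    exact hu
  have hc : Commute (algebraMap R (Module.End R (CechPiece x M t)) (∏ j ∈ s, x j))
      (algebraMap R (Module.End R (CechPiece x M t)) (∏ j ∈ t \ s, x j)) :=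
    Algebra.commutes _ _
  simpa only [map_pow] using ((hc.isUnit_mul_iff.1 hu).1).pow k

/-- The natural localization map between two such localizations of `M`, for `s ⊆ t`. -/
noncomputable def cechRes {s t : Finset (Fin ℓ)} (h : s ⊆ t) :
    CechPiece x M s →ₗ[R] CechPiece x M t :=
  LocalizedModule.lift (Submonoid.powers (∏ j ∈ s, x j)) (LocalizedModule.mkLinearMap _ M)
    (isUnit_of_mem_powers x M h)

/-- The differential of the (total) Čech complex `C(x₁) ⊗ ⋯ ⊗ C(x_ℓ) ⊗ M`, whose terms are the
localizations of `M` at the products of subfamilies of `x`. -/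
noncomputable def cechD : (∀ s, CechPiece x M s) →ₗ[R] (∀ s, CechPiece x M s) :=
  LinearMap.pi fun t => ∑ j ∈ t,
    sgn R t j • (cechRes x M (t.erase_subset j) ∘ₗ LinearMap.proj (t.erase j))

/-- `Cⁱ(x; M)`: the families supported on the subsets with exactly `i` elements. -/
def cechCochains (i : ℕ) : Submodule R (∀ s, CechPiece x M s) where
  carrier := {c | ∀ s, s.card ≠ i → c s = 0}
  add_mem' {c e} hc he s hs := by simp [hc s hs, he s hs]
  zero_mem' s _ := rfl
  smul_mem' r c hc s hs := by simp [hc s hs]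

/-- The `i`-cocycles of the Čech complex. -/
noncomputable def cechCocycles (i : ℕ) : Submodule R (∀ s, CechPiece x M s) :=
  cechCochains x M i ⊓ LinearMap.ker (cechD x M)

/-- The `i`-coboundaries of the Čech complex. -/
noncomputable def cechCoboundaries : ℕ → Submodule R (∀ s, CechPiece x M s)
  | 0 => ⊥
  | i + 1 => (cechCochains x M i).map (cechD x M)

theorem cechRes_apply_comp {s t t' : Finset (Fin ℓ)} (h : s ⊆ t) (h' : t ⊆ t')
    (c : CechPiece x M s) : cechRes x M h' (cechRes x M h c) = cechRes x M (h.trans h') c := by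
  have hh : cechRes x M h' ∘ₗ cechRes x M h = cechRes x M (h.trans h') := by
    symm
    refine LocalizedModule.lift_unique _ _ (isUnit_of_mem_powers x M (h.trans h')) _ ?_
    unfold cechRes
    rw [LinearMap.comp_assoc, LocalizedModule.lift_comp, LocalizedModule.lift_comp]
  exact LinearMap.congr_fun hh c

theorem cechRes_congr {s s' t : Finset (Fin ℓ)} (e : s = s') (h : s ⊆ t) (h' : s' ⊆ t)
    (c : ∀ s, CechPiece x M s) : cechRes x M h (c s) = cechRes x M h' (c s') := by
  subst e
  rfl

theorem cechD_apply (c : ∀ s, CechPiece x M s) (t : Finset (Fin ℓ)) :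
    cechD x M c t = ∑ j ∈ t, sgn R t j • cechRes x M (t.erase_subset j) (c (t.erase j)) := by
  simp only [cechD, LinearMap.pi_apply, LinearMap.sum_apply]
  rfl

/-- The Čech differential squares to zero. -/
theorem cechD_cechD (c : ∀ s, CechPiece x M s) : cechD x M (cechD x M c) = 0 := by
  funext t
  rw [cechD_apply]
  simp only [cechD_apply, map_sum, map_smul, Finset.smul_sum, cechRes_apply_comp, Pi.zero_apply]
  rw [Finset.sum_sigma']
  refine Finset.sum_involution (fun a _ => ⟨a.2, a.1⟩) ?_ ?_ ?_ ?_
  · rintro ⟨j, k⟩ h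
    simp only [Finset.mem_sigma, Finset.mem_erase] at h
    dsimp only
    obtain ⟨hj, hkj, hk⟩ := h
    rw [cechRes_congr x M (Finset.erase_right_comm (s := t) (a := k) (b := j)) _
      (((t.erase j).erase_subset k).trans (t.erase_subset j)), smul_smul, smul_smul, ← add_smul]
    have h1 : t.erase j = insert k ((t.erase j).erase k) :=
      (Finset.insert_erase (by simp [hkj, hk])).symm
    have h2 : t.erase k = insert j ((t.erase j).erase k) := by
      rw [Finset.erase_right_comm]
      exact (Finset.insert_erase (by simp [Ne.symm hkj, hj])).symm
    have h3 : t = insert j (insert k ((t.erase j).erase k)) := by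
      rw [← h1, Finset.insert_erase hj]
    have hs : sgn R t j * sgn R (t.erase j) k + sgn R t k * sgn R (t.erase k) j = 0 := by
      set s := (t.erase j).erase k with hsdef
      have hjs : j ∉ s := by simp [hsdef]
      have hks : k ∉ s := by simp [hsdef]
      have hjs' : j ∉ insert k s := by simp [hjs, Ne.symm hkj]
      rw [h1, h2, h3, sgn_insert (insert k s) hjs', sgn_insert (insert k s) hjs',
        sgn_insert s hks, sgn_insert s hks, sgn_insert s hjs]
      rcases lt_or_gt_of_ne hkj with hlt | hlt
      · simp [hlt, hlt.not_gt]
        ring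
      · simp [hlt, hlt.not_gt]
        ring
    rw [hs, zero_smul]
  · rintro ⟨j, k⟩ h _ he
    simp only [Finset.mem_sigma, Finset.mem_erase] at h
    simp only [Sigma.mk.injEq, heq_eq_eq] at he
    exact h.2.1 he.1
  · rintro ⟨j, k⟩ h
    simp only [Finset.mem_sigma, Finset.mem_erase] at h ⊢
    exact ⟨h.2.2, Ne.symm h.2.1, h.1⟩
  · rintro ⟨j, k⟩ _
    rfl

theorem cechCoboundaries_le_cocycles (i : ℕ) : cechCoboundaries x M i ≤ cechCocycles x M i := by
  cases i with
  | zero => exact bot_le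
  | succ i =>
    rintro _ ⟨w, hw, rfl⟩
    refine ⟨fun s hs => ?_, cechD_cechD x M w⟩
    rw [cechD_apply]
    refine Finset.sum_eq_zero fun j hj => ?_
    have hc := Finset.card_erase_add_one hj
    rw [hw (s.erase j) (by omega), map_zero, smul_zero]

/-- The Čech cohomology `Hⁱₓ(M)`. -/
abbrev CechCohomology (i : ℕ) : Type (max u v) :=
  cechCocycles x M i ⧸ (cechCoboundaries x M i).submoduleOf (cechCocycles x M i)

end Cech

section CohenMacaulay

variable {R : Type u} [CommRing R] (M : Type v) [AddCommGroup M] [Module R M]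

/-- `x` is a parameter sequence on `M`; by convention the empty sequence always is one. -/
def IsParameterSequence (x : List R) : Prop :=
  x = [] ∨
    (IsWeaklyProregular x.get M ∧
      (Ideal.ofList x • ⊤ : Submodule R M) ≠ ⊤ ∧
      ∀ p ∈ Module.support R (M ⧸ (Ideal.ofList x • ⊤ : Submodule R M)),
        Nontrivial (LocalizedModule p.asIdeal.primeCompl (CechCohomology x.get M x.length)))

/-- `x` is a strong parameter sequence on `M`. -/
def IsStrongParameterSequence (x : List R) : Prop :=
  ∀ i : ℕ, 1 ≤ i → i ≤ x.length → IsParameterSequence M (x.take i)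

/-- `x` is an `M`-regular sequence; by convention the empty sequence always is one, even on the
zero module. -/
def IsRegularSequence (x : List R) : Prop :=
  x = [] ∨ RingTheory.Sequence.IsRegular M x

variable (R) in
/-- Cohen-Macaulay modules over an arbitrary commutative ring. -/
def IsCohenMacaulayModule : Prop :=
  ∀ x : List R, IsStrongParameterSequence M x → IsRegularSequence M x

/-- Cohen-Macaulay rings. -/
def IsCohenMacaulayRing (A : Type u) [CommRing A] : Prop := IsCohenMacaulayModule A A

end CohenMacaulay

/-- The amalgamation `R ⋈^f J` of `R` with `S` along `J` with respect to `f`, as a subring of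
`R × S`. -/
def amalgamation {R : Type u} {S : Type v} [CommRing R] [CommRing S] (f : R →+* S) (J : Ideal S) :
    Subring (R × S) where
  carrier := {a | ∃ r : R, ∃ j ∈ J, a = (r, f r + j)}
  mul_mem' := by
    rintro _ _ ⟨r, j, hj, rfl⟩ ⟨r', j', hj', rfl⟩
    refine ⟨r * r', f r * j' + j * f r' + j * j', ?_, ?_⟩
    · exact J.add_mem (J.add_mem (J.mul_mem_left _ hj') (J.mul_mem_right _ hj))
        (J.mul_mem_left _ hj')
    · ext
      · rfl
      · simp only [Prod.mk_mul_mk, map_mul]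
        ring
  one_mem' := ⟨1, 0, J.zero_mem, by simp [Prod.ext_iff]⟩
  add_mem' := by
    rintro _ _ ⟨r, j, hj, rfl⟩ ⟨r', j', hj', rfl⟩
    refine ⟨r + r', j + j', J.add_mem hj hj', ?_⟩
    ext
    · rfl
    · simp only [Prod.mk_add_mk, map_add]
      ring
  zero_mem' := ⟨0, 0, J.zero_mem, by simp [Prod.ext_iff]⟩
  neg_mem' := by
    rintro _ ⟨r, j, hj, rfl⟩
    refine ⟨-r, -j, J.neg_mem hj, ?_⟩
    ext
    · rfl
    · simp only [Prod.neg_mk, map_neg]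
      ring

end NonNoethCM

/-! Write `A` for the amalgamation. As an `R`-module `A` is `R ⊕ J`, with `R` embedded by `r ↦ (r, f
r)` and `J` by `j ↦ (0, j)`. So `A` is flat over `R`, and the first projection is a ring retraction
of `A` onto `R`. Strong parameter sequences on `R` therefore stay so on `A`
(`IsStrongParameterSequence.map_of_flat`): flatness carries weak proregularity and nonvanishing of
top Čech cohomology upwards, and the retraction keeps the extended ideal proper. Cohen–Macaulayness
of `A` makes the image `A`-regular, and weak regularity descends to the summands `R` and `J`
(`isWeaklyRegular_of_retract`). Flatness enters these ascent arguments only through equations: a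
solution in `A` of a homogeneous linear system over `R` is a combination of solutions in `R`
(`exists_solutions_of_flat`). Hence both conditions are first put in terms of elements. -/

namespace NonNoethCM

universe u v w

/-! ### Top Čech cohomology in terms of equations. -/

section TopCech

variable {R : Type u} [CommRing R] {ℓ : ℕ} (x : Fin ℓ → R) (M : Type v) [AddCommGroup M] [Module R M]

/-- The `k`-th power of `∏ j ∈ s, x j`, as a denominator. -/
def cechDen (s : Finset (Fin ℓ)) (k : ℕ) : Submonoid.powers (∏ j ∈ s, x j) :=
  ⟨(∏ j ∈ s, x j) ^ k, k, rfl⟩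

variable {M}

theorem mk_add_mk_same (S : Submonoid R) (d : S) (a b : M) :
    LocalizedModule.mk a d + LocalizedModule.mk b d = LocalizedModule.mk (a + b) d := by
  rw [LocalizedModule.mk_add_mk, ← smul_add, LocalizedModule.mk_cancel_common_left]

theorem sum_mk_same {ι : Type*} (t : Finset ι) (S : Submonoid R) (d : S) (a : ι → M) :
    ∑ i ∈ t, LocalizedModule.mk (a i) d = LocalizedModule.mk (∑ i ∈ t, a i) d := by
  classical
  induction t using Finset.induction_on with
  | empty => simp
  | insert i t hi ih => rw [Finset.sum_insert hi, Finset.sum_insert hi, ih, mk_add_mk_same]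

theorem mk_cechDen_add (s : Finset (Fin ℓ)) (k l : ℕ) (m : M) :
    LocalizedModule.mk ((∏ j ∈ s, x j) ^ l • m) (cechDen x s (k + l)) =
      LocalizedModule.mk m (cechDen x s k) := by
  have h : cechDen x s (k + l) = cechDen x s k * cechDen x s l := by
    ext
    exact pow_add _ _ _
  rw [h]
  exact LocalizedModule.mk_cancel_common_right (cechDen x s k) (cechDen x s l) m

theorem exists_eq_mk_cechDen (s : Finset (Fin ℓ)) (c : CechPiece x M s) :
    ∃ (k : ℕ) (m : M), c = LocalizedModule.mk m (cechDen x s k) := by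
  induction c using LocalizedModule.induction_on with
  | h m d =>
    obtain ⟨_, k, rfl⟩ := d
    exact ⟨k, m, rfl⟩

theorem exists_common_cechDen {ι : Type*} [Fintype ι] (s : ι → Finset (Fin ℓ))
    (c : ∀ i, CechPiece x M (s i)) :
    ∃ (N : ℕ) (m : ι → M), ∀ i, c i = LocalizedModule.mk (m i) (cechDen x (s i) N) := by
  choose k m h using fun i => exists_eq_mk_cechDen x (s i) (c i)
  refine ⟨Finset.univ.sup k, fun i => (∏ j ∈ s i, x j) ^ (Finset.univ.sup k - k i) • m i,
    fun i => ?_⟩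
  have hk : Finset.univ.sup k = k i + (Finset.univ.sup k - k i) :=
    (Nat.add_sub_cancel' (Finset.le_sup (Finset.mem_univ i))).symm
  have h1 := mk_cechDen_add x (s i) (k i) (Finset.univ.sup k - k i) (m i)
  rw [← hk] at h1
  rw [h i, h1]

theorem cechRes_mk {s t : Finset (Fin ℓ)} (h : s ⊆ t) (k : ℕ) (m : M) :
    cechRes x M h (LocalizedModule.mk m (cechDen x s k)) =
      LocalizedModule.mk ((∏ j ∈ t \ s, x j) ^ k • m) (cechDen x t k) := by
  have hu := isUnit_of_mem_powers x M h (cechDen x s k)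
  -- The source denominator acts bijectively on the target, so it may be cleared from both sides.
  refine ((Module.End.isUnit_iff _).1 hu).1 ?_
  have he : ((cechDen x s k : Submonoid.powers (∏ j ∈ s, x j)) : R) *
      (∏ j ∈ t \ s, x j) ^ k = (cechDen x t k : Submonoid.powers (∏ j ∈ t, x j)) := by
    simp only [cechDen]
    rw [← mul_pow, mul_comm, Finset.prod_sdiff h]
  simp only [Module.algebraMap_end_apply]
  rw [← map_smul, LocalizedModule.smul'_mk, LocalizedModule.smul'_mk, smul_smul, he]
  have h1 := LocalizedModule.mk_cancel (cechDen x s k) m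
  have h2 := LocalizedModule.mk_cancel (cechDen x t k) m
  rw [Submonoid.smul_def] at h1 h2
  rw [h1, h2]
  exact LinearMap.congr_fun (LocalizedModule.lift_comp _ _ (isUnit_of_mem_powers x M h)) m

theorem sgn_mul_self (s : Finset (Fin ℓ)) (j : Fin ℓ) : sgn R s j * sgn R s j = 1 := by
  rw [sgn, ← mul_pow]
  simp

/-- A cochain of top degree is a coboundary iff it is so after clearing denominators. -/
theorem single_mem_cechCoboundaries_iff (hℓ : 0 < ℓ) (n : ℕ) (m : M) :
    (Pi.single Finset.univ (LocalizedModule.mk m (cechDen x Finset.univ n)) :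
        ∀ s, CechPiece x M s) ∈ cechCoboundaries x M ℓ ↔
      ∃ (k : ℕ) (b : Fin ℓ → M), (∏ j, x j) ^ k • m = ∑ i, x i ^ (n + k) • b i := by
  have hsd (j : Fin ℓ) : ∏ i ∈ Finset.univ \ Finset.univ.erase j, x i = x j := by
    rw [Finset.sdiff_erase (Finset.mem_univ j)]
    simp
  obtain ⟨i, rfl⟩ : ∃ i, ℓ = i + 1 := ⟨ℓ - 1, by omega⟩
  constructor
  · rintro ⟨w, -, hw⟩
    have hu := congr_fun hw Finset.univ
    rw [Pi.single_eq_same, cechD_apply] at hu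
    obtain ⟨N, a, ha⟩ := exists_common_cechDen x (fun j => Finset.univ.erase j)
      (fun j => w (Finset.univ.erase j))
    simp only [ha, cechRes_mk, LocalizedModule.smul'_mk, hsd] at hu
    rw [sum_mk_same, LocalizedModule.mk_eq] at hu
    obtain ⟨⟨_, K, rfl⟩, hK⟩ := hu
    simp only [cechDen, Submonoid.smul_def, smul_smul, Finset.smul_sum] at hK
    -- `N` is a common denominator of the components of `w`, and `K` is the power that turns
    -- equality of fractions into equality in `M`.
    refine ⟨K + N, fun j => ((∏ i ∈ Finset.univ.erase j, x i) ^ (n + K) * sgn R Finset.univ j) • a j,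
      ?_⟩
    rw [pow_add, ← hK]
    refine Finset.sum_congr rfl fun j _ => ?_
    rw [smul_smul]
    congr 1
    rw [← Finset.mul_prod_erase Finset.univ x (Finset.mem_univ j)]
    ring
  · rintro ⟨k, b, hb⟩
    classical
    -- Only `s = univ.erase j` matters, where the sum over `sᶜ` reduces to the term `j`; its sign
    -- cancels that of the differential.
    refine ⟨fun s => if s.card = i then
      LocalizedModule.mk (∑ j ∈ sᶜ, sgn R Finset.univ j • b j) (cechDen x s (n + k)) else 0,
      fun s hs => if_neg hs, ?_⟩
    funext t
    rw [cechD_apply]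
    by_cases ht : t = Finset.univ
    · subst ht
      rw [Pi.single_eq_same, ← mk_cechDen_add x Finset.univ n k m, hb, ← sum_mk_same]
      refine Finset.sum_congr rfl fun j _ => ?_
      rw [if_pos (by simp), cechRes_mk, LocalizedModule.smul'_mk, hsd, Finset.compl_erase]
      simp only [Finset.compl_univ, insert_empty_eq, Finset.sum_singleton, smul_smul]
      congr 2
      linear_combination (x j ^ (n + k)) * sgn_mul_self (R := R) Finset.univ j
    · rw [Pi.single_eq_of_ne ht]
      refine Finset.sum_eq_zero fun j hj => ?_
      have h1 : t.card < i + 1 := by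
        simpa using Finset.card_lt_card (Finset.ssubset_univ_iff.2 ht)
      rw [if_neg, map_zero, smul_zero]
      rw [Finset.card_erase_of_mem hj]
      have := Finset.card_pos.2 ⟨j, hj⟩
      omega

theorem cechCochains_top_eq_single {c : ∀ s, CechPiece x M s} (hc : c ∈ cechCochains x M ℓ) :
    c = Pi.single Finset.univ (c Finset.univ) := by
  funext t
  by_cases ht : t = Finset.univ
  · subst ht
    rw [Pi.single_eq_same]
  · rw [Pi.single_eq_of_ne ht]
    refine hc t fun h => ht ?_
    exact Finset.eq_univ_of_card _ (by simpa using h)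

theorem single_mem_cechCocycles (a : CechPiece x M Finset.univ) :
    (Pi.single Finset.univ a : ∀ s, CechPiece x M s) ∈ cechCocycles x M ℓ := by
  refine ⟨fun s hs => Pi.single_eq_of_ne (by rintro rfl; simp at hs) _, ?_⟩
  change cechD x M _ = 0
  funext t
  rw [cechD_apply]
  refine Finset.sum_eq_zero fun j hj => ?_
  rw [Pi.single_eq_of_ne, map_zero, smul_zero]
  exact fun h => Finset.notMem_erase j t (h ▸ Finset.mem_univ j)

/-- The localization of the top Čech cohomology of a ring at a prime ideal is nonzero iff
the class of some `1 / (∏ j, x j) ^ n` is. -/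
theorem nontrivial_localizedModule_cechCohomology_iff (hℓ : 0 < ℓ) (p : Ideal R) [p.IsPrime] :
    Nontrivial (LocalizedModule p.primeCompl (CechCohomology x R ℓ)) ↔
      ∃ n : ℕ, ∀ s ∉ p, ∀ (k : ℕ) (b : Fin ℓ → R),
        (∏ j, x j) ^ k * s ≠ ∑ i, x i ^ (n + k) * b i := by
  rw [← not_subsingleton_iff_nontrivial, LocalizedModule.subsingleton_iff]
  push Not
  have key (c : cechCocycles x R ℓ) (n : ℕ) (m s : R)
      (hc : c.1 = Pi.single Finset.univ (LocalizedModule.mk m (cechDen x Finset.univ n))) :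
      (s • (Submodule.Quotient.mk c : CechCohomology x R ℓ) = 0) ↔
        ∃ (k : ℕ) (b : Fin ℓ → R), (∏ j, x j) ^ k * (s * m) = ∑ i, x i ^ (n + k) * b i := by
    rw [← Submodule.Quotient.mk_smul, Submodule.Quotient.mk_eq_zero]
    change s • c.1 ∈ cechCoboundaries x R ℓ ↔ _
    have hs : s • c.1 = Pi.single Finset.univ
        (LocalizedModule.mk (s • m) (cechDen x Finset.univ n)) := by
      rw [hc, ← LocalizedModule.smul'_mk]
      exact (map_smul (LinearMap.single R (CechPiece x R) Finset.univ) s _).symm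
    rw [hs]
    exact single_mem_cechCoboundaries_iff x hℓ n _
  constructor
  · rintro ⟨η, hη⟩
    induction η using Submodule.Quotient.induction_on with
    | H c =>
      obtain ⟨n, m, hm⟩ := exists_eq_mk_cechDen x Finset.univ (c.1 Finset.univ)
      have hc := cechCochains_top_eq_single x c.2.1
      rw [hm] at hc
      -- The class `η` is `m` times the class of `1 / (∏ j, x j) ^ n`, so whatever kills the latter
      -- kills `η`.
      refine ⟨n, fun s hs k b hb => hη s hs ((key c n m s hc).2 ⟨k, fun i => b i * m, ?_⟩)⟩
      rw [← mul_assoc, hb, Finset.sum_mul]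
      exact Finset.sum_congr rfl fun _ _ => mul_assoc _ _ _
  · rintro ⟨n, hn⟩
    refine ⟨Submodule.Quotient.mk ⟨_, single_mem_cechCocycles x
      (LocalizedModule.mk 1 (cechDen x Finset.univ n))⟩, fun s hs h0 => ?_⟩
    obtain ⟨k, b, hb⟩ := (key _ n 1 s rfl).1 h0
    exact hn s hs k b (by rwa [mul_one] at hb)

end TopCech

/-! ### Linear equations in flat modules and ascent of weak proregularity. -/

section Flat

/-- The equational criterion for flatness, for a finite system of equations. -/
theorem exists_solutions_of_flat {R : Type u} [CommRing R] {M : Type v} [AddCommGroup M]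
    [Module R M] [Module.Flat R M] {κ σ : Type*} [Fintype κ] [Fintype σ] (C : κ → σ → R)
    (z : σ → M) (h : ∀ k, ∑ s, C k s • z s = 0) :
    ∃ (n : ℕ) (b : Fin n → M) (c : Fin n → σ → R),
      (∀ s, z s = ∑ i, c i s • b i) ∧ ∀ i k, ∑ s, C k s * c i s = 0 := by
  classical
  have h0 : Fintype.linearCombination R z ∘ₗ Fintype.linearCombination R C = 0 := by
    ext k
    simpa [Fintype.linearCombination_apply, Pi.single_apply] using h k
  obtain ⟨n, a, y, hz, ha⟩ := Module.Flat.exists_factorization_of_comp_eq_zero_of_free h0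
  refine ⟨n, fun i => y (Finsupp.single i 1), fun i s => a (Pi.single s 1) i, fun s => ?_,
    fun i k => ?_⟩
  · have h1 := LinearMap.congr_fun hz (Pi.single s 1)
    simp only [Fintype.linearCombination_apply_single, one_smul, LinearMap.comp_apply] at h1
    rw [h1]
    conv_lhs => rw [← Finsupp.univ_sum_single (a (Pi.single s 1))]
    rw [map_sum]
    refine Finset.sum_congr rfl fun i _ => ?_
    rw [← map_smul, Finsupp.smul_single, smul_eq_mul, mul_one]
  · have h1 := LinearMap.congr_fun ha (Pi.single k 1)
    simp only [Fintype.linearCombination_apply_single, one_smul, LinearMap.comp_apply,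
      LinearMap.zero_apply] at h1
    have h2 : C k = ∑ s, C k s • (Pi.single s (1 : R) : σ → R) := by
      simpa using (pi_eq_sum_univ' (C k))
    rw [h2] at h1
    have h3 := DFunLike.congr_fun h1 i
    simpa using h3

/-- A tensor in the kernel has both components in the kernels for `M` and `N`, which vanish; it is
the sum of the images of its components. -/
theorem flat_prod {R : Type u} [CommRing R] {M : Type v} {N : Type w} [AddCommGroup M]
    [Module R M] [AddCommGroup N] [Module R N] [Module.Flat R M] [Module.Flat R N] :
    Module.Flat R (M × N) := by
  rw [Module.Flat.iff_lTensor_injective']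
  intro I
  rw [injective_iff_map_eq_zero]
  intro t ht
  have h1 : (LinearMap.fst R M N).rTensor I t = 0 := by
    refine (injective_iff_map_eq_zero _).1 (Module.Flat.iff_lTensor_injective'.1 ‹_› I) _ ?_
    rw [← LinearMap.comp_apply, LinearMap.lTensor_comp_rTensor, ← LinearMap.rTensor_comp_lTensor,
      LinearMap.comp_apply, ht, map_zero]
  have h2 : (LinearMap.snd R M N).rTensor I t = 0 := by
    refine (injective_iff_map_eq_zero _).1 (Module.Flat.iff_lTensor_injective'.1 ‹_› I) _ ?_
    rw [← LinearMap.comp_apply, LinearMap.lTensor_comp_rTensor, ← LinearMap.rTensor_comp_lTensor,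
      LinearMap.comp_apply, ht, map_zero]
  have h3 : LinearMap.inl R M N ∘ₗ LinearMap.fst R M N +
      LinearMap.inr R M N ∘ₗ LinearMap.snd R M N = LinearMap.id := by
    ext <;> simp
  have h4 := LinearMap.congr_fun (congrArg (LinearMap.rTensor I) h3) t
  rwa [LinearMap.rTensor_add, LinearMap.rTensor_comp, LinearMap.rTensor_comp, LinearMap.add_apply,
    LinearMap.comp_apply, LinearMap.comp_apply, h1, h2, map_zero, map_zero, add_zero,
    LinearMap.rTensor_id, LinearMap.id_apply, eq_comm] at h4

variable {R : Type u} [CommRing R] {A : Type v} [CommRing A] [Algebra R A]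

theorem sgn_algebraMap {ℓ : ℕ} (s : Finset (Fin ℓ)) (j : Fin ℓ) :
    algebraMap R A (sgn R s j) = sgn A s j := by
  simp [sgn]

theorem koszulHomologyMap_eq_zero_iff {ℓ : ℕ} (x : Fin ℓ → R) (M : Type w) [AddCommGroup M]
    [Module R M] {n m : ℕ} (h : n ≤ m) (i : ℕ) :
    koszulHomologyMap x M h i = 0 ↔
      ∀ z ∈ koszulCycles (x ^ m) M i, koszulPhi x M n m z ∈ koszulBoundaries (x ^ n) M i := by
  constructor
  · intro h0 z hz
    have h1 := LinearMap.congr_fun h0 (Submodule.Quotient.mk ⟨z, hz⟩)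
    rw [LinearMap.zero_apply] at h1
    exact (Submodule.Quotient.mk_eq_zero ((koszulBoundaries (x ^ n) M i).submoduleOf
      (koszulCycles (x ^ n) M i))).1 h1
  · intro h0
    refine LinearMap.ext fun q => ?_
    induction q using Submodule.Quotient.induction_on with
    | H z => exact (Submodule.Quotient.mk_eq_zero _).2 (h0 z.1 z.2)

/-- The Koszul differential of a linear combination, with coefficients in an algebra, of chains over
the base ring. -/
theorem koszulD_sum_smul {ℓ n : ℕ} (x : Fin ℓ → R) (b : Fin n → A)
    (c : Fin n → Finset (Fin ℓ) → R) :
    koszulD (algebraMap R A ∘ x) A (fun s => ∑ i, c i s • b i) =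
      fun s => ∑ i, koszulD x R (c i) s • b i := by
  funext s
  simp only [koszulD, LinearMap.coe_mk, AddHom.coe_mk, Function.comp_apply, Finset.sum_smul,
    smul_eq_mul, Finset.mul_sum]
  rw [Finset.sum_comm]
  refine Finset.sum_congr rfl fun i _ => Finset.sum_congr rfl fun j _ => ?_
  simp only [Algebra.smul_def, map_mul, sgn_algebraMap]
  ring

theorem algebraMap_comp_pow {ℓ : ℕ} (x : Fin ℓ → R) (n : ℕ) :
    (algebraMap R A ∘ x) ^ n = algebraMap R A ∘ (x ^ n) := by
  funext i
  simp

/-- The Koszul cycles of a flat algebra are generated by those of the base ring. -/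
theorem exists_of_mem_koszulCycles [Module.Flat R A] {ℓ : ℕ} (x : Fin ℓ → R) (i : ℕ)
    {z : Finset (Fin ℓ) → A} (hz : z ∈ koszulCycles (algebraMap R A ∘ x) A i) :
    ∃ (n : ℕ) (b : Fin n → A) (c : Fin n → Finset (Fin ℓ) → R),
      (z = fun s => ∑ k, c k s • b k) ∧ ∀ k, c k ∈ koszulCycles x R i := by
  classical
  -- The linear system defining `i`-cycles: the left rows say that the differential vanishes, the
  -- right rows that the coefficients off subsets of size `i` do.
  let C : Finset (Fin ℓ) ⊕ {s : Finset (Fin ℓ) // s.card ≠ i} → Finset (Fin ℓ) → R :=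
    Sum.elim (fun s t => koszulD x R (Pi.single t 1) s) fun s => Pi.single s.1 1
  have hD (t : Finset (Fin ℓ)) (y : Finset (Fin ℓ) → R) :
      ∑ s, C (Sum.inl t) s * y s = koszulD x R y t := by
    conv_rhs => rw [pi_eq_sum_univ' y, map_sum, Finset.sum_apply]
    refine Finset.sum_congr rfl fun s _ => ?_
    rw [map_smul]
    exact mul_comm _ _
  have hDA (t : Finset (Fin ℓ)) :
      ∑ s, C (Sum.inl t) s • z s = koszulD (algebraMap R A ∘ x) A z t := by
    have : z = ∑ s, z s • (fun u => algebraMap R A ((Pi.single s 1 : Finset (Fin ℓ) → R) u)) := by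
      funext u
      simp [Pi.single_apply]
    conv_rhs => rw [this, map_sum, Finset.sum_apply]
    refine Finset.sum_congr rfl fun s _ => ?_
    rw [map_smul]
    have h1 := congr_fun (koszulD_sum_smul (A := A) (n := 1) x 1 fun _ => Pi.single s 1) t
    simp only [Finset.univ_unique, Finset.sum_singleton, Pi.one_apply,
      ← Algebra.algebraMap_eq_smul_one] at h1
    rw [Pi.smul_apply, h1, Algebra.smul_def, smul_eq_mul, mul_comm]
    rfl
  obtain ⟨n, b, c, hzb, hc⟩ := exists_solutions_of_flat C z (by
    rintro (t | t)
    · rw [hDA]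
      exact congr_fun (show koszulD _ A z = 0 from hz.2) t
    · simpa [C, Pi.single_apply] using hz.1 t.1 t.2)
  refine ⟨n, b, c, funext hzb, fun k => ⟨fun s hs => ?_, ?_⟩⟩
  · simpa [C, Pi.single_apply] using hc k (Sum.inr ⟨s, hs⟩)
  · change koszulD x R (c k) = 0
    funext t
    rw [← hD, hc]
    rfl

/-- The same `m` works: a cycle over `A` is a combination of cycles over `R`, and the chains
bounding their images under `koszulPhi` combine with the same coefficients. -/
theorem IsWeaklyProregular.of_flat [Module.Flat R A] {ℓ : ℕ} {x : Fin ℓ → R}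
    (hx : IsWeaklyProregular x R) : IsWeaklyProregular (algebraMap R A ∘ x) A := by
  intro n
  obtain ⟨m, h, h0⟩ := hx n
  refine ⟨m, h, fun i hi => (koszulHomologyMap_eq_zero_iff _ _ h i).2 fun z hz => ?_⟩
  rw [algebraMap_comp_pow] at hz ⊢
  obtain ⟨r, b, c, rfl, hc⟩ := exists_of_mem_koszulCycles _ i hz
  choose w hw hwc using fun k => (koszulHomologyMap_eq_zero_iff _ _ h i).1 (h0 i hi) (c k) (hc k)
  refine ⟨fun s => ∑ k, w k s • b k, fun s hs => ?_, ?_⟩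
  · refine Finset.sum_eq_zero fun k _ => ?_
    rw [hw k s hs, zero_smul]
  · rw [koszulD_sum_smul]
    funext s
    simp only [hwc, koszulPhi, LinearMap.coe_mk, AddHom.coe_mk, Finset.smul_sum,
      Function.comp_apply, ← map_pow, ← map_prod, algebraMap_smul, smul_assoc]

end Flat

/-! ### Ascent of parameter sequences and descent of regularity. -/

section Descent

variable {R : Type u} [CommRing R] {A : Type v} [CommRing A] [Algebra R A]

theorem ofList_smul_top (x : List R) : (Ideal.ofList x • ⊤ : Submodule R R) = Ideal.ofList x := by
  rw [smul_eq_mul, Ideal.mul_top]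

theorem mem_support_quotient_ofList_iff (x : List R) (p : PrimeSpectrum R) :
    p ∈ Module.support R (R ⧸ (Ideal.ofList x • ⊤ : Submodule R R)) ↔
      Ideal.ofList x ≤ p.asIdeal := by
  rw [ofList_smul_top, Module.support_eq_zeroLocus, Ideal.annihilator_quotient]
  rfl

/-- If `s` kills the class of `1 / (∏ j, x j) ^ n` over `A`, then `s` and the coefficients `b` solve
a homogeneous equation over `R`. In each solution over `R` the coordinate of `s` lies in the
contraction of `P`, so `s ∈ P`. -/
theorem nontrivial_localizedModule_cechCohomology_of_flat [Module.Flat R A] {ℓ : ℕ}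
    (x : Fin ℓ → R) (hℓ : 0 < ℓ) (P : Ideal A) [P.IsPrime]
    (h : Nontrivial (LocalizedModule (P.comap (algebraMap R A)).primeCompl
      (CechCohomology x R ℓ))) :
    Nontrivial (LocalizedModule P.primeCompl (CechCohomology (algebraMap R A ∘ x) A ℓ)) := by
  rw [nontrivial_localizedModule_cechCohomology_iff _ hℓ] at h ⊢
  obtain ⟨n, hn⟩ := h
  refine ⟨n, fun s hs k b hb => hs ?_⟩
  obtain ⟨r, d, c, hz, hc⟩ := exists_solutions_of_flat
    (κ := Unit) (σ := Option (Fin ℓ)) (M := A)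
    (fun _ o => o.elim ((∏ j, x j) ^ k) fun i => - x i ^ (n + k)) (fun o => o.elim s b) (by
      intro _
      simp only [Fintype.sum_option, Option.elim, Algebra.smul_def, map_neg, map_pow, map_prod]
      simp only [Function.comp_apply] at hb
      simp [hb])
  have h1 : s = ∑ i, c i none • d i := hz none
  rw [h1]
  refine P.sum_mem fun i _ => ?_
  rw [Algebra.smul_def]
  refine P.mul_mem_right _ ?_
  change c i none ∈ P.comap (algebraMap R A)
  by_contra hp
  refine hn _ hp k (fun j => c i (some j)) ?_
  have h2 := hc i ()
  simp only [Fintype.sum_option, Option.elim, neg_mul, Finset.sum_neg_distrib] at h2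
  exact add_neg_eq_zero.1 h2

theorem IsParameterSequence.map_of_flat [Module.Flat R A] (π : A →ₐ[R] R) {x : List R}
    (hx : IsParameterSequence R x) : IsParameterSequence A (x.map (algebraMap R A)) := by
  rcases hx with rfl | ⟨hw, hne, hsupp⟩
  · exact Or.inl rfl
  by_cases hx0 : x = []
  · exact Or.inl (by rw [hx0, List.map_nil])
  refine Or.inr ?_
  have hpos : 0 < x.length := List.length_pos_iff.2 hx0
  -- The length of the mapped list equals `x.length` only propositionally; with `ℓ` and `y` general,
  -- the equality can be substituted.
  have transfer : ∀ (ℓ : ℕ) (h : x.length = ℓ) (y : Fin ℓ → A),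
      (∀ i, y (Fin.cast h i) = algebraMap R A (x.get i)) →
      IsWeaklyProregular y A ∧ ∀ P : Ideal A, ∀ _ : P.IsPrime,
        Nontrivial (LocalizedModule (P.comap (algebraMap R A)).primeCompl
          (CechCohomology x.get R x.length)) →
        Nontrivial (LocalizedModule P.primeCompl (CechCohomology y A ℓ)) := by
    rintro _ rfl y hy
    obtain rfl : y = algebraMap R A ∘ x.get := funext hy
    exact ⟨hw.of_flat, fun P _ => nontrivial_localizedModule_cechCohomology_of_flat _ hpos P⟩
  obtain ⟨h1, h2⟩ := transfer _ (List.length_map (algebraMap R A)).symm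
    (x.map (algebraMap R A)).get (fun i => by simp)
  refine ⟨h1, fun h => hne ?_, fun P hP => h2 P.asIdeal inferInstance ?_⟩
  · rw [ofList_smul_top] at h ⊢
    -- Applying the retraction `π` to `xA = A` would give `xR = R`.
    have h3 := congrArg (Ideal.map (π : A →+* R)) h
    rw [← Ideal.map_ofList, Ideal.map_map, Ideal.map_top] at h3
    have h4 : (π : A →+* R).comp (algebraMap R A) = RingHom.id R := π.comp_algebraMap
    rwa [h4, Ideal.map_id] at h3
  · refine hsupp (PrimeSpectrum.comap (algebraMap R A) P) ?_
    rw [mem_support_quotient_ofList_iff, ← Ideal.map_ofList] at *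
    exact Ideal.map_le_iff_le_comap.1 hP

theorem IsStrongParameterSequence.map_of_flat [Module.Flat R A] (π : A →ₐ[R] R) {x : List R}
    (hx : IsStrongParameterSequence R x) :
    IsStrongParameterSequence A (x.map (algebraMap R A)) := by
  intro i hi hix
  rw [← List.map_take]
  exact (hx i hi (by simpa using hix)).map_of_flat π

theorem IsStrongParameterSequence.ofList_smul_top_ne {M : Type v} [AddCommGroup M] [Module R M]
    {x : List R} (hx : IsStrongParameterSequence M x) (h0 : x ≠ []) :
    (Ideal.ofList x • ⊤ : Submodule R M) ≠ ⊤ := by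
  have h1 := hx x.length (List.length_pos_iff.2 h0) le_rfl
  rw [List.take_length] at h1
  exact (h1.resolve_left h0).2.1

/-- Weak regularity passes to direct summands. -/
theorem isWeaklyRegular_of_retract {M : Type v} {N : Type w} [AddCommGroup M] [Module R M]
    [AddCommGroup N] [Module R N] (ι : N →ₗ[R] M) (ρ : M →ₗ[R] N) (h : ρ ∘ₗ ι = LinearMap.id)
    {x : List R} (hx : RingTheory.Sequence.IsWeaklyRegular M x) :
    RingTheory.Sequence.IsWeaklyRegular N x := by
  refine ⟨fun i hi => ?_⟩
  have h1 := hx.regular_mod_prev i hi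
  rw [isSMulRegular_quotient_iff_mem_of_smul_mem] at h1 ⊢
  intro n hn
  have h2 := Submodule.smul_top_le_comap_smul_top (Ideal.ofList (x.take i)) ι hn
  rw [Submodule.mem_comap, map_smul] at h2
  have h3 := Submodule.smul_top_le_comap_smul_top (Ideal.ofList (x.take i)) ρ (h1 _ h2)
  rwa [Submodule.mem_comap, ← LinearMap.comp_apply, h, LinearMap.id_apply] at h3

/-- Over a ring with a flat Cohen-Macaulay algebra that retracts onto it, a strong parameter
sequence on the ring is regular on every direct summand of the algebra that it does not
generate. -/
theorem IsCohenMacaulayRing.isRegularSequence_of_retract [Module.Flat R A]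
    (hA : IsCohenMacaulayRing A) (π : A →ₐ[R] R) {N : Type w} [AddCommGroup N] [Module R N]
    (ι : N →ₗ[R] A) (ρ : A →ₗ[R] N) (h : ρ ∘ₗ ι = LinearMap.id) {x : List R}
    (hx : IsStrongParameterSequence R x)
    (hne : x ≠ [] → (Ideal.ofList x • ⊤ : Submodule R N) ≠ ⊤) : IsRegularSequence N x := by
  by_cases h0 : x = []
  · exact Or.inl h0
  have h1 := (hA _ (hx.map_of_flat π)).resolve_left (by simpa using h0)
  -- Only weak regularity descends to a summand; properness on `N` comes from `hne`.
  have h2 := (RingTheory.Sequence.isWeaklyRegular_map_algebraMap_iff A A x).1 h1.toIsWeaklyRegular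
  exact Or.inr ⟨isWeaklyRegular_of_retract ι ρ h h2, (hne h0).symm⟩

end Descent

/-! ### The amalgamation as an extension of `R`. -/

section Amalgamation

variable {R : Type u} {S : Type v} [CommRing R] [CommRing S] (f : R →+* S) (J : Ideal S)

/-- The embedding `r ↦ (r, f r)` of `R` in its amalgamation with `S` along `J`. -/
def amalgamationMap : R →+* amalgamation f J :=
  ((RingHom.id R).prod f).codRestrict (amalgamation f J) fun r => ⟨r, 0, J.zero_mem, by simp⟩

theorem sub_mem_of_mem_amalgamation (a : amalgamation f J) : a.1.2 - f a.1.1 ∈ J := by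
  obtain ⟨_, r, j, hj, rfl⟩ := a
  simpa using hj

end Amalgamation

end NonNoethCM

theorem mainTheorem11 {R : Type*} {S : Type*} [CommRing R] [CommRing S]
    (f : R →+* S) (J : Ideal S) :
    -- `J` is regarded as an `R`-module through `f`
    letI : Module R J := Module.compHom J f
    Module.Flat R J → NonNoethCM.IsCohenMacaulayRing (NonNoethCM.amalgamation f J) →
      NonNoethCM.IsCohenMacaulayRing R ∧
        ((∀ x : List R, NonNoethCM.IsStrongParameterSequence J x →
            NonNoethCM.IsStrongParameterSequence R x) →
          NonNoethCM.IsCohenMacaulayModule R J) := by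
  let _ : Module R J := Module.compHom J f
  intro hJ hA
  let _ : Algebra R (NonNoethCM.amalgamation f J) := (NonNoethCM.amalgamationMap f J).toAlgebra
  let π : NonNoethCM.amalgamation f J →ₐ[R] R :=
    { (RingHom.fst R S).comp (NonNoethCM.amalgamation f J).subtype with commutes' := fun _ => rfl }
  have hsmul (r : R) (j : J) : ((r • j : J) : S) = f r * j := rfl
  have hsmul' (r : R) (a : NonNoethCM.amalgamation f J) :
      (r • a).1 = (r * a.1.1, f r * a.1.2) := rfl
  let ι : J →ₗ[R] NonNoethCM.amalgamation f J :=
    { toFun := fun j => ⟨(0, j), 0, j, j.2, by simp⟩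
      map_add' := fun j k => Subtype.ext (by simp)
      map_smul' := fun r j => Subtype.ext (by simp [hsmul, hsmul']) }
  let ρ : NonNoethCM.amalgamation f J →ₗ[R] J :=
    { toFun := fun a => ⟨a.1.2 - f a.1.1, NonNoethCM.sub_mem_of_mem_amalgamation f J a⟩
      map_add' := fun a b => Subtype.ext (by
        simp only [Subring.coe_add, Prod.fst_add, Prod.snd_add, map_add, Submodule.coe_add]
        ring)
      map_smul' := fun r a => Subtype.ext (by
        simp only [hsmul, hsmul', map_mul, RingHom.id_apply]
        ring) }
  have hρι : ρ ∘ₗ ι = LinearMap.id := by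
    ext j
    simp [ρ, ι]
  have hflat : Module.Flat R (NonNoethCM.amalgamation f J) := by
    have := NonNoethCM.flat_prod (R := R) (M := R) (N := J)
    -- The maps are `a ↦ (a.1, a.2 - f a.1)` and `(r, j) ↦ (r, f r + j)`.
    refine Module.Flat.of_retract (M := R × J) (π.toLinearMap.prod ρ)
      ((Algebra.linearMap R _).coprod ι) (LinearMap.ext fun a => Subtype.ext ?_)
    have h1 : (algebraMap R (NonNoethCM.amalgamation f J) a.1.1).1 = (a.1.1, f a.1.1) := rfl
    change (algebraMap R (NonNoethCM.amalgamation f J) a.1.1).1 + (0, a.1.2 - f a.1.1) = a.1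
    rw [h1, Prod.mk_add_mk, add_zero, add_sub_cancel]
  -- For `J`, the extra assumption `h` makes `x` a strong parameter sequence on `R`, while `xJ ≠ J`
  -- comes from the one on `J`.
  refine ⟨fun x hx => hA.isRegularSequence_of_retract π (Algebra.linearMap R _) π.toLinearMap ?_ hx
      hx.ofList_smul_top_ne, fun h x hx => hA.isRegularSequence_of_retract π ι ρ hρι (h x hx)
      hx.ofList_smul_top_ne⟩
  ext
  simp
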